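/- Let $p$ be a prime and let $G=G_{(1,0)}^{(p)}$ be the group of nilpotency class $2$ generated by $a_1,a_2,b_1,b_2$ subject to (besides the class-$2$ laws $[[x,y],z]=1$) the relations $$a_1^p=[a_1,b_1],\quad a_2^p=[a_1,b_1],\quad b_1^p=[a_2,b_1b_2],\quad b_2^p=[a_2,b_2],\quad [a_1,a_2]=[b_1,b_2]=1.$$ Let $\zeta G$ be its centre, let $\Omega_1(G)$ be the subgroup generated by all $g\in G$ with $g^p=1$, and let $$\mathcal R=\{a_1^{k_1}a_2^{k_2}b_1^{l_1}b_2^{l_2}\mid 0\le k_1,k_2,l_1,l_2\le p-1\}.$$ Then: (i) $\mathcal R$ is a set of coset representatives of $\zeta G$ in $G$, and a function $f:\{a_1,a_2,b_1,b_2\}\to\mathcal R$ extends to an endomorphism of $G$ if and only if either $f$ maps each generator to itself or the image of $f$ is contained in $\langle a_1a_2^{-1}\rangle\,\zeta G$ (that is, modulo the centre, in the cyclic group generated by $a_1a_2^{-1}$). (ii) If $\mathcal R'$ is any set of coset representatives of $\zeta G$ in $G$ that contains $a_1,a_2,b_1,b_2$ and the cyclic subgroup $\langle a_1a_2^{-1}\rangle$,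 then a function $f:\{a_1,a_2,b_1,b_2\}\to\mathcal R'$ extends to an endomorphism of $G$ if and only if either $f$ maps each generator to itself or the image of $f$ is contained in $\langle a_1a_2^{-1}\rangle$. (iii) $\Omega_1(G)=\langle a_1a_2^{-1}\rangle\,\zeta G$ is abelian, and every endomorphism of $G$ that is not an automorphism maps $G$ into $\Omega_1(G)$. -/

import Mathlib

open scoped commutatorElement

/-- The four generator symbols `a₁, a₂, b₁, b₂` of the JK-groups. -/
inductive JKGen : Type
  | a1
  | a2
  | b1
  | b2

/-- The relators presenting the JK-group with parameters `p` and `(l₁, l₂)`: all triple commutators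
(nilpotency class at most `2`), together with the relations
`a₁ ^ p = [a₁, b₁]`, `a₂ ^ p = [a₁, b₁ ^ l₁ * b₂ ^ l₂]`, `b₁ ^ p = [a₂, b₁ * b₂]`,
`b₂ ^ p = [a₂, b₂]`, `[a₁, a₂] = 1`, `[b₁, b₂] = 1`. -/
def jkRelators (p l₁ l₂ : ℕ) : Set (FreeGroup JKGen) :=
  let a₁ : FreeGroup JKGen := FreeGroup.of JKGen.a1
  let a₂ : FreeGroup JKGen := FreeGroup.of JKGen.a2
  let b₁ : FreeGroup JKGen := FreeGroup.of JKGen.b1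
  let b₂ : FreeGroup JKGen := FreeGroup.of JKGen.b2
  {r | ∃ x y z : FreeGroup JKGen, r = ⁅⁅x, y⁆, z⁆} ∪
    {a₁ ^ p * ⁅a₁, b₁⁆⁻¹,
      a₂ ^ p * ⁅a₁, b₁ ^ l₁ * b₂ ^ l₂⁆⁻¹,
      b₁ ^ p * ⁅a₂, b₁ * b₂⁆⁻¹,
      b₂ ^ p * ⁅a₂, b₂⁆⁻¹,
      ⁅a₁, a₂⁆,
      ⁅b₁, b₂⁆}

/-- The JK-group `G_{(l₁, l₂)}^{(p)}`. -/
abbrev JKGroup (p l₁ l₂ : ℕ) : Type := PresentedGroup (jkRelators p l₁ l₂)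

/-- The generator of the JK-group belonging to a generator symbol. -/
def jkGen (p l₁ l₂ : ℕ) (x : JKGen) : JKGroup p l₁ l₂ := PresentedGroup.of x

/-- The normalized elements: those in whose normal form
`a₁ ^ k₁ a₂ ^ k₂ b₁ ^ m₁ b₂ ^ m₂ [a₁, b₁] ^ r₁ [a₁, b₂] ^ r₂ [a₂, b₁] ^ r₃ [a₂, b₂] ^ r₄`
(all exponents in `{0, …, p - 1}`) the exponents `r₁, …, r₄` of the commutators are `0`. -/
def jkNormalized (p l₁ l₂ : ℕ) : Set (JKGroup p l₁ l₂) :=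
  {g | ∃ k₁ k₂ m₁ m₂ : ℕ, k₁ < p ∧ k₂ < p ∧ m₁ < p ∧ m₂ < p ∧
    g = jkGen p l₁ l₂ JKGen.a1 ^ k₁ * jkGen p l₁ l₂ JKGen.a2 ^ k₂ *
      jkGen p l₁ l₂ JKGen.b1 ^ m₁ * jkGen p l₁ l₂ JKGen.b2 ^ m₂}

/-- A function on the generators extends to an endomorphism of the JK-group. -/
def ExtendsToEnd {p l₁ l₂ : ℕ} (f : JKGen → JKGroup p l₁ l₂) : Prop :=
  ∃ φ : JKGroup p l₁ l₂ →* JKGroup p l₁ l₂, ∀ x : JKGen, φ (jkGen p l₁ l₂ x) = f x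

/-- The omega subgroup `Ω₁(G)` with respect to `p`: the subgroup generated by all elements whose
order divides `p`. -/
def omegaOne (p : ℕ) (G : Type*) [Group G] : Subgroup G :=
  Subgroup.closure {g : G | g ^ p = 1}

/-- The cyclic subgroup `⟨a₁ a₂⁻¹⟩` of the JK-group. -/
def jkCyclic (p l₁ l₂ : ℕ) : Subgroup (JKGroup p l₁ l₂) :=
  Subgroup.zpowers (jkGen p l₁ l₂ JKGen.a1 * (jkGen p l₁ l₂ JKGen.a2)⁻¹)

/-! Elements of `G` have normal forms whose commutator exponents, like the exponent vector (k₁, k₂,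
l₁, l₂) modulo the centre, live in 𝔽_p. Commutators and p-th powers depend only on these vectors
(`commutator_jkWord`, `jkWord_pow`), so the images of the generators under an endomorphism satisfy
polynomial equations over 𝔽_p. By `endo_classification` these have two kinds of solutions: the
vectors of the generators themselves, or vectors all of whose p-th powers vanish, that is, multiples
of (1, -1, 0, 0). Conversely, ⟨a₁a₂⁻¹⟩ζG is abelian of exponent p, so any four of its elements
satisfy the relations.

That nothing collapses in `G` is shown by realizing it as a quotient of an explicit integral group
(`jkWord_eq_iff`). An endomorphism congruent to the identity modulo the centre fixes the centre and
is bijective (`bijective_of_central`), which leaves the degenerate solutions for all other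
endomorphisms. -/

/-! ### The integral class-two group and its power relations -/

/-- The integral version of the groups of class two under consideration: normal forms
`a₁ ^ k₁ a₂ ^ k₂ b₁ ^ l₁ b₂ ^ l₂ [a₁, b₁] ^ r₁₁ [a₁, b₂] ^ r₁₂ [a₂, b₁] ^ r₂₁ [a₂, b₂] ^ r₂₂`
with integral exponents. -/
@[ext]
structure NormalForm : Type where
  k1 : ℤ
  k2 : ℤ
  l1 : ℤ
  l2 : ℤ
  r11 : ℤ
  r12 : ℤ
  r21 : ℤ
  r22 : ℤ

namespace NormalForm

instance : Mul NormalForm where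
  -- The b-part of x is moved past the a-part of y by b^l a^k = a^k b^l [a,b]^(-lk).
  mul x y := ⟨x.k1 + y.k1, x.k2 + y.k2, x.l1 + y.l1, x.l2 + y.l2,
    x.r11 + y.r11 - x.l1 * y.k1, x.r12 + y.r12 - x.l2 * y.k1,
    x.r21 + y.r21 - x.l1 * y.k2, x.r22 + y.r22 - x.l2 * y.k2⟩

instance : One NormalForm where
  one := ⟨0, 0, 0, 0, 0, 0, 0, 0⟩

instance : Inv NormalForm where
  inv x := ⟨-x.k1, -x.k2, -x.l1, -x.l2,
    -x.r11 - x.l1 * x.k1, -x.r12 - x.l2 * x.k1,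
    -x.r21 - x.l1 * x.k2, -x.r22 - x.l2 * x.k2⟩

@[simp] lemma mul_def (x y : NormalForm) : x * y =
    ⟨x.k1 + y.k1, x.k2 + y.k2, x.l1 + y.l1, x.l2 + y.l2,
    x.r11 + y.r11 - x.l1 * y.k1, x.r12 + y.r12 - x.l2 * y.k1,
    x.r21 + y.r21 - x.l1 * y.k2, x.r22 + y.r22 - x.l2 * y.k2⟩ := rfl

lemma one_def : (1 : NormalForm) = ⟨0, 0, 0, 0, 0, 0, 0, 0⟩ := rfl

@[simp] lemma inv_def (x : NormalForm) : x⁻¹ = ⟨-x.k1, -x.k2, -x.l1, -x.l2,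
    -x.r11 - x.l1 * x.k1, -x.r12 - x.l2 * x.k1,
    -x.r21 - x.l1 * x.k2, -x.r22 - x.l2 * x.k2⟩ := rfl

instance : Group NormalForm :=
  Group.ofLeftAxioms
    (fun x y z => by ext <;> simp <;> ring)
    (fun x => by ext <;> simp [one_def])
    (fun x => by ext <;> simp [one_def] <;> ring)

lemma commutator_eq (x y : NormalForm) : ⁅x, y⁆ = ⟨0, 0, 0, 0,
    x.k1 * y.l1 - y.k1 * x.l1, x.k1 * y.l2 - y.k1 * x.l2,
    x.k2 * y.l1 - y.k2 * x.l1, x.k2 * y.l2 - y.k2 * x.l2⟩ := by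
  rw [commutatorElement_def]
  ext <;> simp <;> ring

lemma pow_eq (x : NormalForm) (n : ℕ) : x ^ n =
    ⟨n * x.k1, n * x.k2, n * x.l1, n * x.l2,
    n * x.r11 - n.choose 2 * (x.l1 * x.k1), n * x.r12 - n.choose 2 * (x.l2 * x.k1),
    n * x.r21 - n.choose 2 * (x.l1 * x.k2), n * x.r22 - n.choose 2 * (x.l2 * x.k2)⟩ := by
  induction n with
  | zero => simp [one_def]
  | succ n ih =>
    rw [pow_succ, ih]
    ext <;> simp [Nat.choose_succ_succ' n 1] <;> ring

lemma triple_commutator_eq_one (x y z : NormalForm) : ⁅⁅x, y⁆, z⁆ = 1 := by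
  rw [commutator_eq, commutator_eq, one_def]
  simp

/-- The normal subgroup of relations by which the `p`-th powers of the generators of `G_{(1,0)}`
are identified with commutators. -/
def powerRelations (p : ℕ) : Subgroup NormalForm where
  -- Replacing the p-th powers by the commutators they equal adds m₁ + m₂, 0, n₁, n₁ + n₂ to the
  -- commutator exponents, which count only modulo p.
  carrier := {x | ∃ m₁ m₂ n₁ n₂ : ℤ,
    x.k1 = p * m₁ ∧ x.k2 = p * m₂ ∧ x.l1 = p * n₁ ∧ x.l2 = p * n₂ ∧
    (p : ℤ) ∣ x.r11 + (m₁ + m₂) ∧ (p : ℤ) ∣ x.r12 ∧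
    (p : ℤ) ∣ x.r21 + n₁ ∧ (p : ℤ) ∣ x.r22 + (n₁ + n₂)}
  one_mem' := ⟨0, 0, 0, 0, by simp [one_def]⟩
  mul_mem' := by
    rintro ⟨k1, k2, l1, l2, r11, r12, r21, r22⟩ ⟨k1', k2', l1', l2', r11', r12', r21', r22'⟩
      ⟨m₁, m₂, n₁, n₂, rfl, rfl, rfl, rfl, ⟨s, hs⟩, ⟨t, ht⟩, ⟨u, hu⟩, ⟨v, hv⟩⟩
      ⟨m₁', m₂', n₁', n₂', rfl, rfl, rfl, rfl, ⟨s', hs'⟩, ⟨t', ht'⟩, ⟨u', hu'⟩, ⟨v', hv'⟩⟩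
    refine ⟨m₁ + m₁', m₂ + m₂', n₁ + n₁', n₂ + n₂', ?_, ?_, ?_, ?_,
      ⟨s + s' - p * n₁ * m₁', ?_⟩, ⟨t + t' - p * n₂ * m₁', ?_⟩,
      ⟨u + u' - p * n₁ * m₂', ?_⟩, ⟨v + v' - p * n₂ * m₂', ?_⟩⟩ <;> simp at * <;>
      grind
  inv_mem' := by
    rintro ⟨k1, k2, l1, l2, r11, r12, r21, r22⟩
      ⟨m₁, m₂, n₁, n₂, rfl, rfl, rfl, rfl, ⟨s, hs⟩, ⟨t, ht⟩, ⟨u, hu⟩, ⟨v, hv⟩⟩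
    refine ⟨-m₁, -m₂, -n₁, -n₂, ?_, ?_, ?_, ?_,
      ⟨-s - p * n₁ * m₁, ?_⟩, ⟨-t - p * n₂ * m₁, ?_⟩,
      ⟨-u - p * n₁ * m₂, ?_⟩, ⟨-v - p * n₂ * m₂, ?_⟩⟩ <;> simp at * <;> grind

instance (p : ℕ) : (powerRelations p).Normal where
  conj_mem := by
    rintro ⟨k1, k2, l1, l2, r11, r12, r21, r22⟩
      ⟨m₁, m₂, n₁, n₂, rfl, rfl, rfl, rfl, ⟨s, hs⟩, ⟨t, ht⟩, ⟨u, hu⟩, ⟨v, hv⟩⟩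
      ⟨k1', k2', l1', l2', r11', r12', r21', r22'⟩
    refine ⟨m₁, m₂, n₁, n₂, ?_, ?_, ?_, ?_,
      ⟨s + k1' * n₁ - m₁ * l1', ?_⟩, ⟨t + k1' * n₂ - m₁ * l2', ?_⟩,
      ⟨u + k2' * n₁ - m₂ * l1', ?_⟩, ⟨v + k2' * n₂ - m₂ * l2', ?_⟩⟩ <;> simp at * <;> grind

/-- The four commutators stay independent of order p in the quotient: zero generator exponents force
all mᵢ, nᵢ to vanish. -/
lemma central_mem_powerRelations {p : ℕ} (hp : p ≠ 0) {r11 r12 r21 r22 : ℤ} :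
    (⟨0, 0, 0, 0, r11, r12, r21, r22⟩ : NormalForm) ∈ powerRelations p ↔
      (p : ℤ) ∣ r11 ∧ (p : ℤ) ∣ r12 ∧ (p : ℤ) ∣ r21 ∧ (p : ℤ) ∣ r22 := by
  constructor
  · rintro ⟨m₁, m₂, n₁, n₂, hm₁, hm₂, hn₁, hn₂, h⟩
    have hp' : (p : ℤ) ≠ 0 := by exact_mod_cast hp
    simp only [zero_eq_mul, hp', false_or] at hm₁ hm₂ hn₁ hn₂
    subst hm₁ hm₂ hn₁ hn₂
    simpa using h
  · intro h
    exact ⟨0, 0, 0, 0, by simpa using h⟩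

lemma zpow_eq (x : NormalForm) (h11 : x.l1 * x.k1 = 0) (h12 : x.l2 * x.k1 = 0)
    (h21 : x.l1 * x.k2 = 0) (h22 : x.l2 * x.k2 = 0) (n : ℤ) : x ^ n =
    ⟨n * x.k1, n * x.k2, n * x.l1, n * x.l2, n * x.r11, n * x.r12, n * x.r21, n * x.r22⟩ := by
  induction n with
  | zero => simp [one_def]
  | succ n ih =>
    rw [zpow_add_one, ih]
    ext <;> simp <;> grind
  | pred n ih =>
    rw [zpow_sub_one, ih]
    ext <;> simp <;> grind

/-- The generators of the group of normal forms. -/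
def gen : JKGen → NormalForm
  | .a1 => ⟨1, 0, 0, 0, 0, 0, 0, 0⟩
  | .a2 => ⟨0, 1, 0, 0, 0, 0, 0, 0⟩
  | .b1 => ⟨0, 0, 1, 0, 0, 0, 0, 0⟩
  | .b2 => ⟨0, 0, 0, 1, 0, 0, 0, 0⟩

lemma eq_prod_zpow (x : NormalForm) :
    gen .a1 ^ x.k1 * gen .a2 ^ x.k2 * (gen .b1 ^ x.l1 * gen .b2 ^ x.l2) *
      (⁅gen .a1, gen .b1⁆ ^ x.r11 * ⁅gen .a1, gen .b2⁆ ^ x.r12 *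
        ⁅gen .a2, gen .b1⁆ ^ x.r21 * ⁅gen .a2, gen .b2⁆ ^ x.r22) = x := by
  simp only [commutator_eq]
  rw [zpow_eq, zpow_eq, zpow_eq, zpow_eq, zpow_eq, zpow_eq, zpow_eq, zpow_eq] <;> simp [gen]

end NormalForm

/-! ### Collection in groups of class two -/

section ClassTwo

variable {K : Type*} [Group K]

lemma commutator_mem_center_of_classTwo (hK : ∀ x y z : K, ⁅⁅x, y⁆, z⁆ = 1)
    (x y : K) : ⁅x, y⁆ ∈ Subgroup.center K :=
  Subgroup.mem_center_iff.2 fun z => (commutatorElement_eq_one_iff_mul_comm.1 (hK x y z)).symm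

lemma zpow_mul_zpow_of_classTwo (hK : ∀ x y z : K, ⁅⁅x, y⁆, z⁆ = 1) (a b : K) (k l : ℤ) :
    b ^ l * a ^ k = a ^ k * b ^ l * ⁅a, b⁆ ^ (-(l * k)) := by
  have hc : ∀ (g : K) (n : ℤ), Commute g (⁅a, b⁆ ^ n) := fun g n =>
    (show Commute g ⁅a, b⁆ from
      Subgroup.mem_center_iff.1 (commutator_mem_center_of_classTwo hK a b) g).zpow_right n
  -- Conjugation commutes with powers: conjugating by b and raising to k, then conjugating by a⁻ᵏ
  -- and raising to l, gives the formula.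
  have h1 : b * a * b⁻¹ = a * ⁅a, b⁆ ^ (-1 : ℤ) := by
    rw [(hc a (-1)).eq, zpow_neg_one, commutatorElement_inv, commutatorElement_def]
    group
  have h2 : b * a ^ k * b⁻¹ = a ^ k * ⁅a, b⁆ ^ (-k) := by
    rw [← conj_zpow, h1, (hc a (-1)).mul_zpow, ← zpow_mul, neg_one_mul]
  have h3 : (a ^ k)⁻¹ * b * (a ^ k)⁻¹⁻¹ = ⁅a, b⁆ ^ (-k) * b := by
    rw [inv_inv, mul_assoc, inv_mul_eq_iff_eq_mul, ← mul_assoc, ← h2]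
    group
  have h4 : (a ^ k)⁻¹ * b ^ l * (a ^ k)⁻¹⁻¹ = b ^ l * ⁅a, b⁆ ^ (-(l * k)) := by
    rw [← conj_zpow, h3, ((hc b (-k)).symm).mul_zpow, ← zpow_mul, (hc (b ^ l) _).eq]
    congr 2
    ring
  rw [mul_assoc (a ^ k), ← h4]
  group

/-- The homomorphism from the group of normal forms into a group of class two given by elements
satisfying `[a₁, a₂] = [b₁, b₂] = 1`. -/
def NormalForm.lift (hK : ∀ x y z : K, ⁅⁅x, y⁆, z⁆ = 1)
    (f : JKGen → K) (ha : ⁅f .a1, f .a2⁆ = 1) (hb : ⁅f .b1, f .b2⁆ = 1) :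
    NormalForm →* K :=
  MonoidHom.mk' (fun x =>
    f .a1 ^ x.k1 * f .a2 ^ x.k2 * (f .b1 ^ x.l1 * f .b2 ^ x.l2) *
      (⁅f .a1, f .b1⁆ ^ x.r11 * ⁅f .a1, f .b2⁆ ^ x.r12 *
        ⁅f .a2, f .b1⁆ ^ x.r21 * ⁅f .a2, f .b2⁆ ^ x.r22)) (by
    intro x y
    have ha' : Commute (f .a1) (f .a2) := commutatorElement_eq_one_iff_commute.1 ha
    have hb' : Commute (f .b1) (f .b2) := commutatorElement_eq_one_iff_commute.1 hb
    -- Commutators are carried in the commutative group `Subgroup.center K`, where `ac_rfl` can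
    -- finally rearrange them.
    obtain ⟨c11, h11⟩ : ∃ c : Subgroup.center K, (c : K) = ⁅f .a1, f .b1⁆ :=
      ⟨⟨_, commutator_mem_center_of_classTwo hK _ _⟩, rfl⟩
    obtain ⟨c12, h12⟩ : ∃ c : Subgroup.center K, (c : K) = ⁅f .a1, f .b2⁆ :=
      ⟨⟨_, commutator_mem_center_of_classTwo hK _ _⟩, rfl⟩
    obtain ⟨c21, h21⟩ : ∃ c : Subgroup.center K, (c : K) = ⁅f .a2, f .b1⁆ :=
      ⟨⟨_, commutator_mem_center_of_classTwo hK _ _⟩, rfl⟩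
    obtain ⟨c22, h22⟩ : ∃ c : Subgroup.center K, (c : K) = ⁅f .a2, f .b2⁆ :=
      ⟨⟨_, commutator_mem_center_of_classTwo hK _ _⟩, rfl⟩
    have s11 := zpow_mul_zpow_of_classTwo hK (f .a1) (f .b1)
    have s12 := zpow_mul_zpow_of_classTwo hK (f .a1) (f .b2)
    have s21 := zpow_mul_zpow_of_classTwo hK (f .a2) (f .b1)
    have s22 := zpow_mul_zpow_of_classTwo hK (f .a2) (f .b2)
    simp only [← h11, ← h12, ← h21, ← h22, ← Subgroup.coe_zpow, ← Subgroup.coe_mul]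
      at s11 s12 s21 s22 ⊢
    have hc : ∀ (c : Subgroup.center K) (g : K), (c : K) * g = g * c := fun c g =>
      (Subgroup.mem_center_iff.1 c.2 g).symm
    have hc' : ∀ (c : Subgroup.center K) (g g' : K), g * c * g' = g * g' * c := fun c g g' => by
      rw [mul_assoc, hc, mul_assoc]
    have one_side : ∀ (a a' b : K) (c c' : Subgroup.center K), b * a = a * b * c →
        b * a' = a' * b * c' → b * (a * a') = a * a' * b * (c * c' : Subgroup.center K) := by
      intro a a' b c c' h h'
      rw [← mul_assoc, h, hc', mul_assoc a b, h', Subgroup.coe_mul, hc c c']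
      simp only [mul_assoc]
    have swap : ∀ (a b b' : K) (c c' : Subgroup.center K), b * a = a * b * c →
        b' * a = a * b' * c' → b * b' * a = a * (b * b') * (c * c' : Subgroup.center K) := by
      intro a b b' c c' h h'
      rw [mul_assoc, h', ← mul_assoc, ← mul_assoc, h, hc' c, Subgroup.coe_mul]
      simp only [mul_assoc]
    have key' : ∀ (a b a' b' : K) (d c c' : Subgroup.center K), b * a' = a' * b * d →
        a * b * c * (a' * b' * c') = a * a' * (b * b') * (d * c * c' : Subgroup.center K) := by
      intro a b a' b' d c c' h
      have : b * (a' * b') = a' * b * b' * d := by rw [← mul_assoc, h, hc']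
      rw [hc', ← mul_assoc, mul_assoc a b, this]
      simp only [Subgroup.coe_mul, mul_assoc]
      rw [hc c]
    have key := swap _ _ _ _ _ (one_side _ _ _ _ _ (s11 y.k1 x.l1) (s21 y.k2 x.l1))
      (one_side _ _ _ _ _ (s12 y.k1 x.l2) (s22 y.k2 x.l2))
    refine .trans ?_ (key' _ _ _ _ _ _ _ key).symm
    simp only [mul_def, sub_eq_add_neg, zpow_add]
    rw [(ha'.zpow_zpow y.k1 x.k2).mul_mul_mul_comm, (hb'.zpow_zpow y.l1 x.l2).mul_mul_mul_comm]
    congr 2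
    ac_rfl)

end ClassTwo

/-! ### The equations over 𝔽_p -/

section Vectors

variable {K : Type*} [CommRing K]

/-- Exponent vectors `(k₁, k₂, l₁, l₂)` of `a₁ ^ k₁ a₂ ^ k₂ b₁ ^ l₁ b₂ ^ l₂`; also used for the
exponents of the commutators `[a₁, b₁], [a₁, b₂], [a₂, b₁], [a₂, b₂]`. -/
abbrev ExpVec (K : Type*) : Type _ := K × K × K × K

/-- The commutator of two elements with given exponent vectors. -/
def ExpVec.comm (x y : ExpVec K) : ExpVec K :=
  (x.1 * y.2.2.1 - y.1 * x.2.2.1, x.1 * y.2.2.2 - y.1 * x.2.2.2,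
    x.2.1 * y.2.2.1 - y.2.1 * x.2.2.1, x.2.1 * y.2.2.2 - y.2.1 * x.2.2.2)

/-- The `p`-th power of an element with given exponent vector; `ε` stands for `p.choose 2`. -/
def ExpVec.powP (ε : K) (x : ExpVec K) : ExpVec K :=
  (x.1 + x.2.1 - ε * (x.2.2.1 * x.1), -(ε * (x.2.2.2 * x.1)),
    x.2.2.1 - ε * (x.2.2.1 * x.2.1), x.2.2.1 + x.2.2.2 - ε * (x.2.2.2 * x.2.1))

/-- The exponent vectors of `a₁, a₂, b₁, b₂`. -/
def ExpVec.gen : JKGen → ExpVec K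
  | .a1 => (1, 0, 0, 0)
  | .a2 => (0, 1, 0, 0)
  | .b1 => (0, 0, 1, 0)
  | .b2 => (0, 0, 0, 1)

end Vectors

namespace ExpVec

section Field

variable {K : Type*} [Field K]

/-- The hypotheses say (e,f) ⊗ (g',h') = (e',f') ⊗ (g,h); equal nonzero pure tensors have
proportional factors, and the other cases are the ways both sides can vanish. -/
lemma dependent_of_comm_eq_zero (e f g h e' f' g' h' : K)
    (y11 : e * g' - e' * g = 0) (y12 : e * h' - e' * h = 0)
    (y21 : f * g' - f' * g = 0) (y22 : f * h' - f' * h = 0) :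
    (g = 0 ∧ h = 0 ∧ g' = 0 ∧ h' = 0) ∨ (e = 0 ∧ f = 0 ∧ e' = 0 ∧ f' = 0) ∨
    (∃ t, e' = t * e ∧ f' = t * f ∧ g' = t * g ∧ h' = t * h) ∨
    (e = 0 ∧ f = 0 ∧ g = 0 ∧ h = 0) := by
  by_cases he : e = 0
  · by_cases hf : f = 0
    · grind
    · have : e' = 0 ∨ (g = 0 ∧ h = 0) := by grind
      rcases this with h0 | h0
      · right; right; left
        exact ⟨f' / f, by grind, by grind, by grind, by grind⟩
      · left
        grind
  · by_cases h0 : g = 0 ∧ h = 0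
    · left
      grind
    · right; right; left
      have : f' = e' / e * f := by
        by_cases g = 0 <;> grind
      exact ⟨e' / e, by grind, this, by grind, by grind⟩

/-- If `a₁` and `a₂` have the same image and this image does not lie in `⟨a₁, a₂⟩`, then the
defining relations are violated. -/
lemma false_of_equal_images (a b c d e f g h e' f' g' h' : K)
    (hcd : c ≠ 0 ∨ d ≠ 0)
    (y11 : e * g' - e' * g = 0) (y12 : e * h' - e' * h = 0)
    (y21 : f * g' - f' * g = 0) (y22 : f * h' - f' * h = 0)
    (p11 : a + b = a * g - e * c) (p12 : 0 = a * h - e * d)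
    (p21 : c = b * g - f * c) (p22 : c + d = b * h - f * d)
    (r11 : e + f = a * (g + g') - (e + e') * c) (r12 : 0 = a * (h + h') - (e + e') * d)
    (r21 : g = b * (g + g') - (f + f') * c) (r22 : g + h = b * (h + h') - (f + f') * d)
    (s11 : e' + f' = a * g' - e' * c) (s12 : 0 = a * h' - e' * d)
    (s21 : g' = b * g' - f' * c) (s22 : g' + h' = b * h' - f' * d) : False := by
  rcases dependent_of_comm_eq_zero e f g h e' f' g' h' y11 y12 y21 y22 with
    ⟨rfl, rfl, rfl, rfl⟩ | ⟨rfl, rfl, rfl, rfl⟩ | ⟨t, rfl, rfl, rfl, rfl⟩ | ⟨rfl, rfl, rfl, rfl⟩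
  · by_cases c = 0 <;> by_cases d = 0 <;> grind
  · by_cases a = 0 <;> by_cases b = 0 <;> grind
  · by_cases ht : t = 0
    · subst ht
      simp at *
      by_cases d = 0 <;> by_cases a = e <;> grind
    -- Dividing the relations for y' = t y by t and comparing with those for y, whose right sides
    -- carry the factor 1 + t, makes the p-th power of y vanish, hence that of x.
    · have : e + f = 0 := by grind
      have : g = 0 := by grind
      have : h = 0 := by grind
      grind
  · simp at *
    grind

lemma endo_classification_zero (x x' y y' : ExpVec K)
    (hx : x.comm x' = 0) (hy : y.comm y' = 0) (h1 : x.powP 0 = x.comm y)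
    (h2 : x'.powP 0 = x.comm y) (h3 : y.powP 0 = x'.comm (y + y')) (h4 : y'.powP 0 = x'.comm y') :
    (x.powP 0 = 0 ∧ x'.powP 0 = 0 ∧ y.powP 0 = 0 ∧ y'.powP 0 = 0) ∨
    (x = gen .a1 ∧ x' = gen .a2 ∧ y = gen .b1 ∧ y' = gen .b2) := by
  obtain ⟨a, b, c, d⟩ := x
  obtain ⟨a', b', c', d'⟩ := x'
  obtain ⟨e, f, g, h⟩ := y
  obtain ⟨e', f', g', h'⟩ := y'
  have h12 := h1.trans h2.symm
  simp only [comm, powP, gen, Prod.mk.injEq, Prod.mk_eq_zero, Prod.mk_add_mk, zero_mul, sub_zero,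
    neg_zero] at *
  obtain ⟨x11, x12, x21, x22⟩ := hx
  obtain ⟨y11, y12, y21, y22⟩ := hy
  obtain ⟨p11, p12, p21, p22⟩ := h1
  obtain ⟨q1, -, q2, q3⟩ := h12
  replace q3 : d = d' := by grind
  subst q2 q3
  obtain ⟨r11, r12, r21, r22⟩ := h3
  obtain ⟨s11, s12, s21, s22⟩ := h4
  clear h2
  -- Equal p-th powers of x and x' give c = c', d = d'. If (c, d) ≠ 0, commutation of x and x'
  -- forces x = x', which `false_of_equal_images` excludes.
  by_cases hc : c = 0
  · by_cases hd : d = 0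
    · subst hc hd
      simp at *
      by_cases h0 : a + b = 0
      · left
        have hb : b = -a := by grind
        have hb' : b' = -a' := by grind
        subst hb hb'
        have h1 : g' + h' = 0 := by grind
        have h2 : g + h = 0 := by grind
        by_cases ha' : a' = 0
        · grind
        · grind
      · right
        have ha : a ≠ 0 := by grind
        have hh : h = 0 := by grind
        have hb : b = 0 := by grind
        have hg : g = 1 := by grind
        subst hh hb hg
        have : a' + b' = a := by grind
        by_cases hh' : h' = 0
        · grind
        · have ha' : a' = 0 := by grind
          have : g' = 0 ∨ b' = 1 := by grind
          have : b' = 1 := by grind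
          have : e = 0 := by grind
          have : e' = 0 := by grind
          have : f = 0 := by grind
          have : f' = 0 := by grind
          grind
    · exfalso
      have ha : a = a' := by grind
      have hb : b = b' := by grind
      subst ha hb
      exact false_of_equal_images a b c d e f g h e' f' g' h' (.inr hd) y11 y12 y21 y22
        p11 p12 p21 p22 r11 r12 r21 r22 s11 s12 s21 s22
  · exfalso
    have ha : a = a' := by grind
    have hb : b = b' := by grind
    subst ha hb
    exact false_of_equal_images a b c d e f g h e' f' g' h' (.inl hc) y11 y12 y21 y22
      p11 p12 p21 p22 r11 r12 r21 r22 s11 s12 s21 s22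

end Field

lemma powP_eq_zero_iff_zero {K : Type*} [Field K] (x : ExpVec K) :
    x.powP 0 = 0 ↔ x = (x.1, -x.1, 0, 0) := by
  obtain ⟨a, b, c, d⟩ := x
  simp only [powP, Prod.mk.injEq, Prod.mk_eq_zero]
  grind

lemma powP_eq_zero_iff_two : ∀ x : ExpVec (ZMod 2), x.powP 1 = 0 ↔ x = (x.1, -x.1, 0, 0) := by
  decide

-- For p = 2 the binomial coefficient is 1 instead of 0, so a finite check replaces the argument.
-- Each hypothesis stands as early as possible to prune the search.
set_option synthInstance.maxSize 10000 in
lemma endo_classification_two : ∀ x x' : ExpVec (ZMod 2),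
    x.comm x' = 0 → x.powP 1 = x'.powP 1 →
    ∀ y : ExpVec (ZMod 2), x.powP 1 = x.comm y →
    ∀ y' : ExpVec (ZMod 2), y.comm y' = 0 → y.powP 1 = x'.comm (y + y') → y'.powP 1 = x'.comm y' →
    (x.powP 1 = 0 ∧ x'.powP 1 = 0 ∧ y.powP 1 = 0 ∧ y'.powP 1 = 0) ∨
    (x = gen .a1 ∧ x' = gen .a2 ∧ y = gen .b1 ∧ y' = gen .b2) := by
  decide +kernel

lemma choose_two_cast {p : ℕ} (hp : p.Prime) (h2 : p ≠ 2) : (p.choose 2 : ZMod p) = 0 :=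
  (ZMod.natCast_eq_zero_iff _ _).2
    (hp.dvd_choose_self two_ne_zero (lt_of_le_of_ne hp.two_le h2.symm))

lemma powP_eq_zero_iff {p : ℕ} (hp : p.Prime) (x : ExpVec (ZMod p)) :
    x.powP (p.choose 2 : ZMod p) = 0 ↔ x = (x.1, -x.1, 0, 0) := by
  by_cases h2 : p = 2
  · subst h2
    simpa using powP_eq_zero_iff_two x
  · have := Fact.mk hp
    rw [choose_two_cast hp h2]
    exact powP_eq_zero_iff_zero x

/-- The solutions of the equations that the exponent vectors `x, x', y, y'` of the images of
`a₁, a₂, b₁, b₂` under an endomorphism satisfy. -/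
lemma endo_classification {p : ℕ} (hp : p.Prime) (x x' y y' : ExpVec (ZMod p))
    (hx : x.comm x' = 0) (hy : y.comm y' = 0)
    (h1 : x.powP (p.choose 2 : ZMod p) = x.comm y) (h2 : x'.powP (p.choose 2 : ZMod p) = x.comm y)
    (h3 : y.powP (p.choose 2 : ZMod p) = x'.comm (y + y'))
    (h4 : y'.powP (p.choose 2 : ZMod p) = x'.comm y') :
    (x.powP (p.choose 2 : ZMod p) = 0 ∧ x'.powP (p.choose 2 : ZMod p) = 0 ∧
      y.powP (p.choose 2 : ZMod p) = 0 ∧ y'.powP (p.choose 2 : ZMod p) = 0) ∨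
    (x = gen .a1 ∧ x' = gen .a2 ∧ y = gen .b1 ∧ y' = gen .b2) := by
  by_cases hp2 : p = 2
  · subst hp2
    simp only [Nat.choose_self, Nat.cast_one] at *
    exact endo_classification_two x x' hx (h1.trans h2.symm) y h1 y' hy h3 h4
  · have := Fact.mk hp
    rw [choose_two_cast hp hp2] at *
    exact endo_classification_zero x x' y y' hx hy h1 h2 h3 h4

end ExpVec

open ExpVec NormalForm

/-! ### The presentation and its universal property -/

section Presentation

variable {p : ℕ}

lemma jkGroup_triple_commutator {l₁ l₂ : ℕ} (x y z : JKGroup p l₁ l₂) : ⁅⁅x, y⁆, z⁆ = 1 := by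
  obtain ⟨x, rfl⟩ := PresentedGroup.mk_surjective _ x
  obtain ⟨y, rfl⟩ := PresentedGroup.mk_surjective _ y
  obtain ⟨z, rfl⟩ := PresentedGroup.mk_surjective _ z
  rw [← map_commutatorElement, ← map_commutatorElement]
  exact PresentedGroup.one_of_mem (.inl ⟨x, y, z, rfl⟩)

/-- The relations other than the class-two laws, for elements of an arbitrary group. -/
def SatisfiesRelations {K : Type*} [Group K] (p : ℕ) (f : JKGen → K) : Prop :=
  f .a1 ^ p = ⁅f .a1, f .b1⁆ ∧ f .a2 ^ p = ⁅f .a1, f .b1⁆ ∧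
    f .b1 ^ p = ⁅f .a2, f .b1 * f .b2⁆ ∧ f .b2 ^ p = ⁅f .a2, f .b2⁆ ∧
    ⁅f .a1, f .a2⁆ = 1 ∧ ⁅f .b1, f .b2⁆ = 1

lemma satisfiesRelations_of_hom {K : Type*} [Group K] (φ : FreeGroup JKGen →* K)
    (h : ∀ r ∈ jkRelators p 1 0, φ r = 1) : SatisfiesRelations p (fun x => φ (.of x)) := by
  simp only [jkRelators, Set.mem_union, or_imp, forall_and, Set.mem_insert_iff, forall_eq,
    Set.mem_singleton_iff, map_mul, map_inv, map_pow, map_commutatorElement, mul_inv_eq_one,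
    pow_one, pow_zero, mul_one] at h
  simpa only [SatisfiesRelations] using h.2

lemma jkGen_satisfiesRelations : SatisfiesRelations p (jkGen p 1 0) :=
  satisfiesRelations_of_hom (PresentedGroup.mk _) fun _ hr => PresentedGroup.one_of_mem hr

lemma SatisfiesRelations.map {K L : Type*} [Group K] [Group L] {f : JKGen → K}
    (hf : SatisfiesRelations p f) (φ : K →* L) : SatisfiesRelations p (fun x => φ (f x)) := by
  obtain ⟨h1, h2, h3, h4, h5, h6⟩ := hf
  simp only [SatisfiesRelations, ← map_pow, ← map_mul, ← map_commutatorElement, h1, h2, h3, h4,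
    h5, h6, map_one, and_self]

lemma exists_jkGroup_hom {K : Type*} [Group K] (hK : ∀ x y z : K, ⁅⁅x, y⁆, z⁆ = 1)
    {f : JKGen → K} (hf : SatisfiesRelations p f) :
    ∃ φ : JKGroup p 1 0 →* K, ∀ x, φ (jkGen p 1 0 x) = f x := by
  have h : ∀ r ∈ jkRelators p 1 0, FreeGroup.lift f r = 1 := by
    simp only [jkRelators, Set.mem_union, or_imp, forall_and, Set.mem_insert_iff, forall_eq,
      Set.mem_singleton_iff, map_mul, map_inv, map_pow, map_commutatorElement, mul_inv_eq_one,
      pow_one, pow_zero, mul_one, FreeGroup.lift_apply_of]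
    refine ⟨?_, hf⟩
    rintro _ ⟨x, y, z, rfl⟩
    simp only [map_commutatorElement, hK]
  exact ⟨PresentedGroup.toGroup h, fun x => PresentedGroup.toGroup.of h⟩

lemma jkGroup_closure : Subgroup.closure (Set.range (jkGen p 1 0)) = ⊤ :=
  PresentedGroup.closure_range_of _

end Presentation

/-! ### Normal forms in the presented group -/

section Word

variable (p : ℕ)

/-- The element of `G_{(1,0)}` with a given integral normal form. -/
def jkWord : NormalForm →* JKGroup p 1 0 :=
  NormalForm.lift jkGroup_triple_commutator (jkGen p 1 0)
    jkGen_satisfiesRelations.2.2.2.2.1 jkGen_satisfiesRelations.2.2.2.2.2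

lemma jkWord_apply (x : NormalForm) : jkWord p x =
    jkGen p 1 0 .a1 ^ x.k1 * jkGen p 1 0 .a2 ^ x.k2 *
      (jkGen p 1 0 .b1 ^ x.l1 * jkGen p 1 0 .b2 ^ x.l2) *
      (⁅jkGen p 1 0 .a1, jkGen p 1 0 .b1⁆ ^ x.r11 * ⁅jkGen p 1 0 .a1, jkGen p 1 0 .b2⁆ ^ x.r12 *
        ⁅jkGen p 1 0 .a2, jkGen p 1 0 .b1⁆ ^ x.r21 * ⁅jkGen p 1 0 .a2, jkGen p 1 0 .b2⁆ ^ x.r22) :=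
  rfl

lemma jkWord_gen (x : JKGen) : jkWord p (NormalForm.gen x) = jkGen p 1 0 x := by
  rw [jkWord_apply]
  cases x <;> simp [NormalForm.gen]

lemma jkWord_surjective : Function.Surjective (jkWord p) := by
  rw [← MonoidHom.range_eq_top, eq_top_iff, ← jkGroup_closure, Subgroup.closure_le]
  rintro _ ⟨x, rfl⟩
  exact ⟨_, jkWord_gen p x⟩

variable {p}

/-- The quotient by `powerRelations p` satisfies the defining relations, so the projection onto it
factors through `jkWord p`. -/
lemma mem_powerRelations_of_jkWord_eq_one {x : NormalForm} (hx : jkWord p x = 1) :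
    x ∈ powerRelations p := by
  obtain ⟨ψ, hψs, hψ⟩ : ∃ ψ : NormalForm →* NormalForm ⧸ powerRelations p,
      Function.Surjective ψ ∧ ∀ x y, ψ x = ψ y ↔ x⁻¹ * y ∈ powerRelations p :=
    ⟨QuotientGroup.mk' _, QuotientGroup.mk'_surjective _, fun x y => QuotientGroup.eq⟩
  have hgen : SatisfiesRelations p (fun y => ψ (NormalForm.gen y)) := by
    simp only [SatisfiesRelations, ← map_pow, ← map_mul, ← map_commutatorElement, ← map_one ψ, hψ,
      commutator_eq, pow_eq]
    refine ⟨⟨-1, 0, 0, 0, ?_⟩, ⟨0, -1, 0, 0, ?_⟩, ⟨0, 0, -1, 0, ?_⟩, ⟨0, 0, 0, -1, ?_⟩,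
      ⟨0, 0, 0, 0, ?_⟩, ⟨0, 0, 0, 0, ?_⟩⟩ <;> simp [NormalForm.gen, NormalForm.one_def]
  obtain ⟨φ, hφ⟩ := exists_jkGroup_hom (fun x y z => by
    obtain ⟨x, rfl⟩ := hψs x
    obtain ⟨y, rfl⟩ := hψs y
    obtain ⟨z, rfl⟩ := hψs z
    rw [← map_commutatorElement, ← map_commutatorElement, triple_commutator_eq_one, map_one]) hgen
  have h : φ (jkWord p x) = ψ x := by
    conv_rhs => rw [← eq_prod_zpow x]
    simp only [jkWord_apply, map_mul, map_zpow, map_commutatorElement, hφ]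
  rw [hx, map_one, ← map_one ψ, hψ, inv_one, one_mul] at h
  exact h

/-- In class two, [aᵢ, x]^p = [aᵢ^p, x], and aᵢ^p is a commutator, hence central. -/
lemma commutator_pow_eq_one (i j : JKGen) (hi : i = .a1 ∨ i = .a2) :
    ⁅jkGen p 1 0 i, jkGen p 1 0 j⁆ ^ p = 1 := by
  have hpow : jkGen p 1 0 i ^ p = ⁅jkGen p 1 0 .a1, jkGen p 1 0 .b1⁆ := by
    rcases hi with rfl | rfl
    · exact jkGen_satisfiesRelations.1
    · exact jkGen_satisfiesRelations.2.1
  have h := zpow_mul_zpow_of_classTwo jkGroup_triple_commutator (jkGen p 1 0 i) (jkGen p 1 0 j) p 1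
  rw [zpow_one, zpow_natCast, hpow, Subgroup.mem_center_iff.1
    (commutator_mem_center_of_classTwo jkGroup_triple_commutator _ _), left_eq_mul, one_mul,
    zpow_neg, inv_eq_one, zpow_natCast] at h
  exact h

lemma jkWord_central_eq_one {r11 r12 r21 r22 : ℤ} (h11 : (p : ℤ) ∣ r11) (h12 : (p : ℤ) ∣ r12)
    (h21 : (p : ℤ) ∣ r21) (h22 : (p : ℤ) ∣ r22) :
    jkWord p ⟨0, 0, 0, 0, r11, r12, r21, r22⟩ = 1 := by
  obtain ⟨s, rfl⟩ := h11
  obtain ⟨t, rfl⟩ := h12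
  obtain ⟨u, rfl⟩ := h21
  obtain ⟨v, rfl⟩ := h22
  simp only [jkWord_apply, zpow_mul, zpow_natCast, zpow_zero,
    commutator_pow_eq_one .a1 _ (.inl rfl), commutator_pow_eq_one .a2 _ (.inr rfl), one_zpow,
    mul_one]

lemma jkWord_eq_one_of_mem {x : NormalForm} (hx : x ∈ powerRelations p) : jkWord p x = 1 := by
  obtain ⟨k1, k2, l1, l2, r11, r12, r21, r22⟩ := x
  obtain ⟨m₁, m₂, n₁, n₂, rfl, rfl, rfl, rfl, hs, ht, hu, hv⟩ := hx
  obtain ⟨h1, h2, h3, h4, -, -⟩ := jkGen_satisfiesRelations (p := p)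
  rw [← jkWord_central_eq_one hs ht hu hv, jkWord_apply]
  simp only [zpow_mul, zpow_natCast, h1, h2, h3, h4]
  simp only [← jkWord_gen, ← map_mul, ← map_commutatorElement, ← map_zpow]
  congr 1
  simp only [commutator_eq]
  rw [zpow_eq, zpow_eq, zpow_eq, zpow_eq, zpow_eq, zpow_eq, zpow_eq, zpow_eq] <;>
    simp [NormalForm.gen] <;> grind

lemma jkWord_eq_iff {x y : NormalForm} : jkWord p x = jkWord p y ↔ x⁻¹ * y ∈ powerRelations p := by
  rw [← inv_mul_eq_one, ← map_inv, ← map_mul]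
  exact ⟨mem_powerRelations_of_jkWord_eq_one, jkWord_eq_one_of_mem⟩

end Word

/-! ### Centre, commutators and p-th powers by exponent vectors -/

section Center

variable {p : ℕ}

/-- The exponent vector modulo `p` of a normal form. -/
def NormalForm.vec (p : ℕ) (x : NormalForm) : ExpVec (ZMod p) := (x.k1, x.k2, x.l1, x.l2)

lemma NormalForm.vec_mul (x y : NormalForm) : (x * y).vec p = x.vec p + y.vec p := by
  simp [vec]

lemma NormalForm.vec_inv (x : NormalForm) : (x⁻¹).vec p = -x.vec p := by
  simp [vec]

lemma NormalForm.vec_inv_mul_eq_zero {x y : NormalForm} :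
    (x⁻¹ * y).vec p = 0 ↔ y.vec p = x.vec p := by
  rw [vec_mul, vec_inv, neg_add_eq_zero, eq_comm]

lemma NormalForm.vec_gen (x : JKGen) : (NormalForm.gen x).vec p = ExpVec.gen x := by
  cases x <;> simp [vec, NormalForm.gen, ExpVec.gen]

/-- The central element with given commutator exponents. -/
def jkCentral (p : ℕ) (v : ExpVec (ZMod p)) : JKGroup p 1 0 :=
  jkWord p ⟨0, 0, 0, 0, v.1.cast, v.2.1.cast, v.2.2.1.cast, v.2.2.2.cast⟩

lemma jkWord_central_eq_iff [NeZero p] {a b c d a' b' c' d' : ℤ} :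
    jkWord p ⟨0, 0, 0, 0, a, b, c, d⟩ = jkWord p ⟨0, 0, 0, 0, a', b', c', d'⟩ ↔
      (((a : ZMod p), (b : ZMod p), (c : ZMod p), (d : ZMod p)) : ExpVec (ZMod p)) =
        ((a' : ZMod p), (b' : ZMod p), (c' : ZMod p), (d' : ZMod p)) := by
  rw [jkWord_eq_iff]
  simp only [inv_def, mul_def, neg_zero, mul_zero, sub_zero, add_zero]
  rw [central_mem_powerRelations (NeZero.ne p)]
  simp only [Prod.mk.injEq, ZMod.intCast_eq_intCast_iff_dvd_sub, neg_add_eq_sub]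

lemma jkWord_central [NeZero p] (a b c d : ℤ) :
    jkWord p ⟨0, 0, 0, 0, a, b, c, d⟩ = jkCentral p (a, b, c, d) := by
  rw [jkCentral, jkWord_central_eq_iff]
  simp

lemma jkCentral_injective [NeZero p] : Function.Injective (jkCentral p) := by
  intro v w h
  rw [jkCentral, jkCentral, jkWord_central_eq_iff] at h
  simpa [Prod.ext_iff] using h

lemma jkCentral_zero [NeZero p] : jkCentral p 0 = 1 := by
  rw [← map_one (jkWord p), NormalForm.one_def, jkWord_central]
  simp [Prod.zero_eq_mk]

lemma commutator_jkWord [NeZero p] (x y : NormalForm) :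
    ⁅jkWord p x, jkWord p y⁆ = jkCentral p ((x.vec p).comm (y.vec p)) := by
  rw [← map_commutatorElement, commutator_eq, jkWord_central]
  simp [vec, ExpVec.comm]

lemma jkWord_pow [NeZero p] (x : NormalForm) :
    jkWord p x ^ p = jkCentral p ((x.vec p).powP (p.choose 2 : ZMod p)) := by
  have h : jkWord p x ^ p = jkWord p ⟨0, 0, 0, 0,
      x.k1 + x.k2 - p.choose 2 * (x.l1 * x.k1), -(p.choose 2 * (x.l2 * x.k1)),
      x.l1 - p.choose 2 * (x.l1 * x.k2), x.l1 + x.l2 - p.choose 2 * (x.l2 * x.k2)⟩ := by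
    rw [← map_pow, pow_eq, jkWord_eq_iff]
    refine ⟨-x.k1, -x.k2, -x.l1, -x.l2, ?_, ?_, ?_, ?_, ⟨-x.r11 - p * x.l1 * x.k1, ?_⟩,
      ⟨-x.r12 - p * x.l2 * x.k1, ?_⟩, ⟨-x.r21 - p * x.l1 * x.k2, ?_⟩,
      ⟨-x.r22 - p * x.l2 * x.k2, ?_⟩⟩ <;> simp <;> ring
  rw [h, jkWord_central]
  simp [vec, ExpVec.powP]

lemma jkWord_pow_eq_one_iff (hp : p.Prime) (x : NormalForm) :
    jkWord p x ^ p = 1 ↔ x.vec p = ((x.vec p).1, -(x.vec p).1, 0, 0) := by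
  have := Fact.mk hp
  rw [jkWord_pow, ← jkCentral_zero, jkCentral_injective.eq_iff, powP_eq_zero_iff hp]

lemma jkWord_mem_center_iff [NeZero p] {x : NormalForm} :
    jkWord p x ∈ Subgroup.center (JKGroup p 1 0) ↔ x.vec p = 0 := by
  constructor
  · intro h
    have hcomm : ∀ y : JKGen, (x.vec p).comm (ExpVec.gen y) = 0 := fun y => by
      rw [← vec_gen, ← jkCentral_injective.eq_iff, ← commutator_jkWord, jkCentral_zero,
        commutatorElement_eq_one_iff_mul_comm]
      exact (Subgroup.mem_center_iff.1 h _).symm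
    -- The commutator with a₁ reads off l₁, l₂; that with b₁ reads off k₁, k₂.
    have h1 := hcomm .a1
    have h2 := hcomm .b1
    simp only [ExpVec.comm, ExpVec.gen, Prod.mk_eq_zero] at h1 h2
    ext <;> simp_all
  · intro h
    rw [Subgroup.mem_center_iff]
    intro g
    obtain ⟨y, rfl⟩ := jkWord_surjective p g
    rw [eq_comm, ← commutatorElement_eq_one_iff_mul_comm, commutator_jkWord, h, ← jkCentral_zero]
    simp [ExpVec.comm, Prod.zero_eq_mk]

lemma inv_mul_mem_center_iff [NeZero p] {x y : NormalForm} :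
    (jkWord p x)⁻¹ * jkWord p y ∈ Subgroup.center (JKGroup p 1 0) ↔ y.vec p = x.vec p := by
  rw [← map_inv, ← map_mul, jkWord_mem_center_iff, vec_inv_mul_eq_zero]

lemma vec_eq_of_jkWord_eq [NeZero p] {x y : NormalForm} (h : jkWord p x = jkWord p y) :
    x.vec p = y.vec p := by
  rw [← inv_mul_mem_center_iff, h, inv_mul_cancel]
  exact one_mem _

end Center

/-! ### The subgroup of elements of order dividing p -/

section Omega

variable {p : ℕ}

lemma zpow_jkWord_cyclic (n : ℤ) : (jkGen p 1 0 .a1 * (jkGen p 1 0 .a2)⁻¹) ^ n =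
    jkWord p ⟨n, -n, 0, 0, 0, 0, 0, 0⟩ := by
  rw [← jkWord_gen, ← jkWord_gen, ← map_inv, ← map_mul, ← map_zpow, zpow_eq] <;>
    simp [NormalForm.gen]

lemma jkWord_mem_cyclic_sup_center_iff [NeZero p] {x : NormalForm} :
    jkWord p x ∈ jkCyclic p 1 0 ⊔ Subgroup.center (JKGroup p 1 0) ↔
      x.vec p = ((x.vec p).1, -(x.vec p).1, 0, 0) := by
  constructor
  · intro h
    obtain ⟨u, ⟨n, rfl⟩, z, hz, h⟩ := Subgroup.mem_sup_of_normal_right.1 h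
    obtain ⟨z, rfl⟩ := jkWord_surjective p z
    simp only [zpow_jkWord_cyclic, ← map_mul] at h
    rw [← vec_eq_of_jkWord_eq h, vec_mul, jkWord_mem_center_iff.1 hz]
    simp [vec]
  · intro h
    rw [← mul_inv_cancel_left (jkWord p ⟨x.k1, -x.k1, 0, 0, 0, 0, 0, 0⟩) (jkWord p x)]
    refine Subgroup.mul_mem_sup ⟨x.k1, zpow_jkWord_cyclic _⟩ (inv_mul_mem_center_iff.2 ?_)
    rw [h]
    simp [vec]

lemma mem_cyclic_sup_center_iff (hp : p.Prime) {g : JKGroup p 1 0} :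
    g ∈ jkCyclic p 1 0 ⊔ Subgroup.center (JKGroup p 1 0) ↔ g ^ p = 1 := by
  have := Fact.mk hp
  obtain ⟨x, rfl⟩ := jkWord_surjective p g
  rw [jkWord_pow_eq_one_iff hp, jkWord_mem_cyclic_sup_center_iff]

lemma omegaOne_eq (hp : p.Prime) : omegaOne p (JKGroup p 1 0) =
    jkCyclic p 1 0 ⊔ Subgroup.center (JKGroup p 1 0) := by
  have h : {g : JKGroup p 1 0 | g ^ p = 1} =
      (jkCyclic p 1 0 ⊔ Subgroup.center (JKGroup p 1 0) : Subgroup (JKGroup p 1 0)) := by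
    ext g
    exact (mem_cyclic_sup_center_iff hp).symm
  rw [omegaOne, h, Subgroup.closure_eq]

lemma commutator_cyclic_sup_center [NeZero p] {g h : JKGroup p 1 0}
    (hg : g ∈ jkCyclic p 1 0 ⊔ Subgroup.center (JKGroup p 1 0))
    (hh : h ∈ jkCyclic p 1 0 ⊔ Subgroup.center (JKGroup p 1 0)) : ⁅g, h⁆ = 1 := by
  obtain ⟨x, rfl⟩ := jkWord_surjective p g
  obtain ⟨y, rfl⟩ := jkWord_surjective p h
  rw [jkWord_mem_cyclic_sup_center_iff] at hg hh
  rw [commutator_jkWord, hg, hh, ← jkCentral_zero]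
  simp [ExpVec.comm, Prod.zero_eq_mk]

end Omega

/-! ### Endomorphisms -/

section Endomorphisms

variable {p : ℕ}

lemma endomorphism_dichotomy (hp : p.Prime) (φ : JKGroup p 1 0 →* JKGroup p 1 0) :
    (∀ x, (jkGen p 1 0 x)⁻¹ * φ (jkGen p 1 0 x) ∈ Subgroup.center (JKGroup p 1 0)) ∨
      ∀ x, φ (jkGen p 1 0 x) ∈ jkCyclic p 1 0 ⊔ Subgroup.center (JKGroup p 1 0) := by
  have := Fact.mk hp
  choose y hy using fun x => jkWord_surjective p (φ (jkGen p 1 0 x))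
  obtain ⟨h1, h2, h3, h4, h5, h6⟩ := jkGen_satisfiesRelations.map φ
  simp only [← hy, ← map_mul, commutator_jkWord, jkWord_pow, ← jkCentral_zero,
    jkCentral_injective.eq_iff, vec_mul] at h1 h2 h3 h4 h5 h6
  rcases endo_classification hp _ _ _ _ h5 h6 h1 h2 h3 h4 with ⟨e1, e2, e3, e4⟩ | ⟨e1, e2, e3, e4⟩
  · right
    intro x
    rw [← hy, jkWord_mem_cyclic_sup_center_iff, ← powP_eq_zero_iff hp]
    cases x <;> assumption
  · left
    intro x
    rw [← hy, ← jkWord_gen, inv_mul_mem_center_iff, vec_gen]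
    cases x <;> assumption

lemma extendsToEnd_of_mem_cyclic_sup_center (hp : p.Prime) {f : JKGen → JKGroup p 1 0}
    (hf : ∀ x, f x ∈ jkCyclic p 1 0 ⊔ Subgroup.center (JKGroup p 1 0)) : ExtendsToEnd f := by
  have := Fact.mk hp
  refine exists_jkGroup_hom jkGroup_triple_commutator ?_
  have hpow : ∀ x, f x ^ p = 1 := fun x => (mem_cyclic_sup_center_iff hp).1 (hf x)
  simp only [SatisfiesRelations, hpow, commutator_cyclic_sup_center (hf _) (hf _),
    commutator_cyclic_sup_center (hf _) (mul_mem (hf _) (hf _)), and_self]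

lemma extendsToEnd_iff (hp : p.Prime) {R : Set (JKGroup p 1 0)}
    (hR : Subgroup.IsComplement R (Subgroup.center (JKGroup p 1 0) : Set (JKGroup p 1 0)))
    (hgen : ∀ x, jkGen p 1 0 x ∈ R) {f : JKGen → JKGroup p 1 0} (hf : ∀ x, f x ∈ R) :
    ExtendsToEnd f ↔ (∀ x, f x = jkGen p 1 0 x) ∨
      ∀ x, f x ∈ jkCyclic p 1 0 ⊔ Subgroup.center (JKGroup p 1 0) := by
  constructor
  · rintro ⟨φ, hφ⟩
    refine (endomorphism_dichotomy hp φ).imp (fun h x => ?_) (fun h x => hφ x ▸ h x)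
    have hu := (Subgroup.isComplement_iff_existsUnique_inv_mul_mem.1 hR (f x)).unique
      (y₁ := ⟨f x, hf x⟩) (y₂ := ⟨jkGen p 1 0 x, hgen x⟩) (by simp) (hφ x ▸ h x)
    exact congrArg Subtype.val hu
  · rintro (h | h)
    · exact ⟨MonoidHom.id _, fun x => (h x).symm⟩
    · exact extendsToEnd_of_mem_cyclic_sup_center hp h

/-- Commutators depend only on vectors, so φ fixes them and hence the centre, which they generate. A
kernel element is central, so fixed and trivial; correcting g by the central element g⁻¹φ(g) gives a
preimage of g. -/
lemma bijective_of_central (hp : p.Prime) {φ : JKGroup p 1 0 →* JKGroup p 1 0}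
    (hφ : ∀ x, (jkGen p 1 0 x)⁻¹ * φ (jkGen p 1 0 x) ∈ Subgroup.center (JKGroup p 1 0)) :
    Function.Bijective φ := by
  have := Fact.mk hp
  choose y hy using fun x => jkWord_surjective p (φ (jkGen p 1 0 x))
  have hvec : ∀ x, (y x).vec p = ExpVec.gen x := fun x => by
    rw [← vec_gen, ← inv_mul_mem_center_iff, hy, jkWord_gen]
    exact hφ x
  have hcomm : ∀ i j, φ ⁅jkGen p 1 0 i, jkGen p 1 0 j⁆ = ⁅jkGen p 1 0 i, jkGen p 1 0 j⁆ := by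
    intro i j
    rw [map_commutatorElement, ← hy, ← hy, commutator_jkWord, hvec, hvec, ← vec_gen, ← vec_gen,
      ← commutator_jkWord, jkWord_gen, jkWord_gen]
  have hcentral : ∀ z ∈ Subgroup.center (JKGroup p 1 0), φ z = z := by
    intro z hz
    obtain ⟨x, rfl⟩ := jkWord_surjective p z
    have hx := jkWord_mem_center_iff.1 hz
    simp only [vec, Prod.mk_eq_zero, ZMod.intCast_zmod_eq_zero_iff_dvd] at hx
    obtain ⟨⟨m₁, h1⟩, ⟨m₂, h2⟩, ⟨n₁, h3⟩, ⟨n₂, h4⟩⟩ := hx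
    -- The power relations rewrite a central element as a product of commutators.
    have : jkWord p x = jkWord p ⟨0, 0, 0, 0, x.r11 + m₁ + m₂, x.r12, x.r21 + n₁,
        x.r22 + n₁ + n₂⟩ := by
      rw [jkWord_eq_iff]
      refine ⟨-m₁, -m₂, -n₁, -n₂, ?_, ?_, ?_, ?_, ⟨-p * n₁ * m₁, ?_⟩, ⟨-p * n₂ * m₁, ?_⟩,
        ⟨-p * n₁ * m₂, ?_⟩, ⟨-p * n₂ * m₂, ?_⟩⟩ <;> simp [h1, h2, h3, h4] <;> ring
    rw [this, jkWord_apply]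
    simp [hcomm]
  have hmem : ∀ g, g⁻¹ * φ g ∈ Subgroup.center (JKGroup p 1 0) := by
    intro g
    have hg : g ∈ Subgroup.closure (Set.range (jkGen p 1 0)) := jkGroup_closure ▸ Subgroup.mem_top g
    rw [← QuotientGroup.eq]
    have : Set.EqOn (QuotientGroup.mk' (Subgroup.center (JKGroup p 1 0)))
        ((QuotientGroup.mk' (Subgroup.center (JKGroup p 1 0))).comp φ)
        (Subgroup.closure (Set.range (jkGen p 1 0))) := by
      apply MonoidHom.eqOn_closure
      rintro _ ⟨x, rfl⟩
      exact QuotientGroup.eq.2 (hφ x)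
    exact this hg
  constructor
  · rw [injective_iff_map_eq_one]
    intro g hg
    have h := hmem g
    rw [hg, mul_one, inv_mem_iff] at h
    rw [← hcentral g h, hg]
  · intro g
    refine ⟨g * (g⁻¹ * φ g)⁻¹, ?_⟩
    rw [map_mul, hcentral _ (inv_mem (hmem g))]
    group

lemma range_le_of_not_bijective (hp : p.Prime) {φ : JKGroup p 1 0 →* JKGroup p 1 0}
    (hφ : ¬ Function.Bijective φ) :
    φ.range ≤ jkCyclic p 1 0 ⊔ Subgroup.center (JKGroup p 1 0) := by
  have h := (endomorphism_dichotomy hp φ).resolve_left fun h => hφ (bijective_of_central hp h)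
  rw [MonoidHom.range_eq_map, ← jkGroup_closure, MonoidHom.map_closure, Subgroup.closure_le]
  rintro _ ⟨_, ⟨x, rfl⟩, rfl⟩
  exact h x

end Endomorphisms

/-! ### The normalized coset representatives -/

section Normalized

variable {p : ℕ}

lemma mem_jkNormalized_iff {g : JKGroup p 1 0} : g ∈ jkNormalized p 1 0 ↔
    ∃ k₁ k₂ m₁ m₂ : ℕ, k₁ < p ∧ k₂ < p ∧ m₁ < p ∧ m₂ < p ∧
      g = jkWord p ⟨k₁, k₂, m₁, m₂, 0, 0, 0, 0⟩ := by
  simp [jkNormalized, jkWord_apply, mul_assoc]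

lemma jkGen_mem_jkNormalized (hp : p.Prime) (x : JKGen) : jkGen p 1 0 x ∈ jkNormalized p 1 0 := by
  rw [mem_jkNormalized_iff, ← jkWord_gen]
  have h0 := hp.pos
  have h1 := hp.one_lt
  cases x
  · exact ⟨1, 0, 0, 0, h1, h0, h0, h0, rfl⟩
  · exact ⟨0, 1, 0, 0, h0, h1, h0, h0, rfl⟩
  · exact ⟨0, 0, 1, 0, h0, h0, h1, h0, rfl⟩
  · exact ⟨0, 0, 0, 1, h0, h0, h0, h1, rfl⟩

lemma isComplement_jkNormalized (hp : p.Prime) : Subgroup.IsComplement (jkNormalized p 1 0)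
    (Subgroup.center (JKGroup p 1 0) : Set (JKGroup p 1 0)) := by
  have := Fact.mk hp
  rw [Subgroup.isComplement_iff_existsUnique_inv_mul_mem]
  intro g
  obtain ⟨x, rfl⟩ := jkWord_surjective p g
  let s : NormalForm := ⟨(x.k1 : ZMod p).val, (x.k2 : ZMod p).val, (x.l1 : ZMod p).val,
    (x.l2 : ZMod p).val, 0, 0, 0, 0⟩
  refine ⟨⟨jkWord p s, mem_jkNormalized_iff.2 ⟨_, _, _, _, ZMod.val_lt _, ZMod.val_lt _,
    ZMod.val_lt _, ZMod.val_lt _, rfl⟩⟩, ?_, ?_⟩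
  · refine inv_mul_mem_center_iff.2 ?_
    simp [vec, s]
  · rintro ⟨t, ht⟩ h
    obtain ⟨k₁, k₂, m₁, m₂, hk₁, hk₂, hm₁, hm₂, rfl⟩ := mem_jkNormalized_iff.1 ht
    have hv := inv_mul_mem_center_iff.1 h
    simp only [vec, Prod.mk.injEq] at hv
    simp [s, hv, ZMod.val_natCast, Nat.mod_eq_of_lt, hk₁, hk₂, hm₁, hm₂]

end Normalized

/-! ### The main theorem -/

theorem theorem5p1 (p : ℕ) (hp : p.Prime) :
    -- the normalized elements are a set of coset representatives of the centre
    Subgroup.IsComplement (jkNormalized p 1 0) (Subgroup.center (JKGroup p 1 0) : Set (JKGroup p 1 0)) ∧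
    -- the criterion for functions into the normalized elements
    (∀ f : JKGen → JKGroup p 1 0, (∀ x, f x ∈ jkNormalized p 1 0) →
      (ExtendsToEnd f ↔
        (∀ x, f x = jkGen p 1 0 x) ∨
        (∀ x, f x ∈ jkCyclic p 1 0 ⊔ Subgroup.center (JKGroup p 1 0)))) ∧
    -- the criterion for any set of coset representatives containing the generators and `⟨a₁ a₂⁻¹⟩`
    (∀ R : Set (JKGroup p 1 0),
      Subgroup.IsComplement R (Subgroup.center (JKGroup p 1 0) : Set (JKGroup p 1 0)) →
      (∀ x, jkGen p 1 0 x ∈ R) → (jkCyclic p 1 0 : Set (JKGroup p 1 0)) ⊆ R →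
      ∀ f : JKGen → JKGroup p 1 0, (∀ x, f x ∈ R) →
        (ExtendsToEnd f ↔
          (∀ x, f x = jkGen p 1 0 x) ∨ (∀ x, f x ∈ jkCyclic p 1 0))) ∧
    -- the reformulation through the abelian subgroup `Ω₁`
    omegaOne p (JKGroup p 1 0) = jkCyclic p 1 0 ⊔ Subgroup.center (JKGroup p 1 0) ∧
    (∀ g ∈ omegaOne p (JKGroup p 1 0), ∀ h ∈ omegaOne p (JKGroup p 1 0), g * h = h * g) ∧
    (∀ φ : JKGroup p 1 0 →* JKGroup p 1 0, ¬ Function.Bijective φ →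
      φ.range ≤ omegaOne p (JKGroup p 1 0)) := by

  have hR := isComplement_jkNormalized hp
  refine ⟨hR, fun f hf => extendsToEnd_iff hp hR (jkGen_mem_jkNormalized hp) hf, ?_,
    omegaOne_eq hp, ?_, ?_⟩
  · intro R hR hgen hcyc f hf
    rw [extendsToEnd_iff hp hR hgen hf]
    refine or_congr_right ⟨fun h x => ?_, fun h x => Subgroup.mem_sup_left (h x)⟩
    -- Both f x and its cyclic factor u lie in R and in the same coset of the centre, so they
    -- coincide.
    obtain ⟨u, hu, z, hz, huz⟩ := Subgroup.mem_sup_of_normal_right.1 (h x)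
    have hunique := (Subgroup.isComplement_iff_existsUnique_inv_mul_mem.1 hR (f x)).unique
      (y₁ := ⟨f x, hf x⟩) (y₂ := ⟨u, hcyc hu⟩) (by simp) (by simpa [← huz] using hz)
    have : f x = u := congrArg Subtype.val hunique
    exact this ▸ hu
  · intro g hg h hh
    have := Fact.mk hp
    rw [omegaOne_eq hp] at hg hh
    exact commutatorElement_eq_one_iff_mul_comm.1 (commutator_cyclic_sup_center hg hh)
  · intro φ hφ
    rw [omegaOne_eq hp]
    exact range_le_of_not_bijective hp hφ
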